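/- **New linear combination of quantum states.** Consider quantum circuits on $n$ data qubits and finitely many ancilla qubits, all initially in state $|0\rangle$, built from the following steps. - An arbitrary gate on at most three qubits, taking time $1$. - A call of one of $l$ state preparation unitaries $A_0,\dots,A_{l-1}$ on the data register, or of its inverse, controlled by an ancilla qubit, taking time $T_{\rm in}$, where $T_{\rm in}\ge\max(1,n)$ bounds the times needed to prepare the states. - A fractional power: for $U=\sum_j e^{i\theta_j}|u_j\rangle\langle u_j|$ with $\theta_j\in(-\pi,\pi]$ and $0\le r\le 1$ put $U^r=\sum_j e^{ir\theta_j}|u_j\rangle\langle u_j|$. It is assumed that whenever $U$ is implemented by a circuit taking time $C_U$, then $U^r$ can be implemented to accuracy $\delta\in(0,1]$ in time $\kappa\, C_U/\delta$; that is, the step performs some unitary $V$, over which the circuit has no further control, with $\|V-U^r\|\le\delta$ in operator norm. Here $\kappa>0$ is a fixed constant. Then for every $\kappa>0$ there is a constant $K>0$ such that for all $l\ge 1$, $n\ge 0$, all complex numbers $\alpha_0,\dots,\alpha_{l-1}$ and all $0<\varepsilon\le 1$ there is a circuit of this kind, which depends only on $\kappa,l,n,(\alpha_j),\varepsilon$ and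 in particular not on the unitaries $A_j$, with running time at most $$K\,T_{\rm in}\,l^{\log_2(l/\varepsilon)}$$ for every $T_{\rm in}\geq\max(1,n)$, and with the following property: for all $n$-qubit states $|v_0\rangle,\dots,|v_{l-1}\rangle$ and all unitaries $A_j$ with $A_j|0^n\rangle=|v_j\rangle$ such that $v=\sum_{j=0}^{l-1}\alpha_j|v_j\rangle\neq 0$, and for every possible outcome of the approximate fractional-power steps, the circuit maps the all-zero state to a state within norm distance $\varepsilon$ of $\frac{v}{\|v\|}\otimes|0\cdots0\rangle$, with the ancillas in the second factor. In particular, the running time is bounded independently of the coefficients $\alpha_j$ and of the norm $\|v\|$. -/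

import Mathlib

namespace QCircuit

/-- Wires: `n` data qubits and `a` ancilla qubits. -/
abbrev Wire (n a : ℕ) := Fin n ⊕ Fin a

/-- Pure state vectors of the qubits indexed by `ι`, in the computational basis `ι → Bool`. -/
abbrev State (ι : Type) [Fintype ι] := EuclideanSpace ℂ (ι → Bool)

/-- Unitary matrices on the qubits indexed by `ι`. -/
abbrev Unitary (ι : Type) [Fintype ι] [DecidableEq ι] := Matrix.unitaryGroup (ι → Bool) ℂ

/-- Operators on a space of qubits, with the operator norm. -/
abbrev Operator (ι : Type) [Fintype ι] := State ι →L[ℂ] State ι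

/-- The operator on the Euclidean state space given by a matrix. -/
noncomputable def op {ι : Type} [Fintype ι] [DecidableEq ι]
    (M : Matrix (ι → Bool) (ι → Bool) ℂ) : Operator ι :=
  Matrix.toEuclideanCLM (n := ι → Bool) (𝕜 := ℂ) M

/-- The basis state `|0…0⟩`. -/
noncomputable def ket0 (ι : Type) [Fintype ι] [DecidableEq ι] : State ι :=
  EuclideanSpace.single (fun _ => false) 1

/-- `|y⟩|0…0⟩`: the data register holds `y` and all ancillas are `0`. -/
noncomputable def withAncilla {n : ℕ} (a : ℕ) (y : State (Fin n)) : State (Wire n a) :=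
  WithLp.toLp 2 fun x =>
    if ∀ q, x (Sum.inr q) = false then y (fun i => x (Sum.inl i)) else 0

/-- The fractional power `U ^ r = ∑ⱼ exp (i r θⱼ) |uⱼ⟩⟨uⱼ|` of a unitary
`U = ∑ⱼ exp (i θⱼ) |uⱼ⟩⟨uⱼ|`, with eigenphases `θⱼ` in `(-π, π]`, as the functional calculus
of `U` at the principal power function. The spectrum is finite, so every function is continuous
on it. -/
noncomputable def fracPower {ι : Type} [Fintype ι] [DecidableEq ι]
    (U : Unitary ι) (r : ℝ) : Operator ι :=
  cfc (fun z : ℂ => z ^ (r : ℂ)) (op U.1)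

/-- The matrix of a gate `u` applied to the qubits in `S`: `u` on `S`, the identity elsewhere. -/
noncomputable def gateMatrix {n a : ℕ} (S : Finset (Wire n a)) (u : Unitary S) :
    Matrix (Wire n a → Bool) (Wire n a → Bool) ℂ :=
  Matrix.of fun x y =>
    if ∀ i, i ∉ S → x i = y i then u.1 (fun i => x i.1) (fun i => y i.1) else 0

/-- The matrix of `A` on the data register controlled by the ancilla `q`:
`|1⟩⟨1| ⊗ A + |0⟩⟨0| ⊗ 1`. -/
noncomputable def controlledMatrix {n a : ℕ} (A : Unitary (Fin n)) (q : Fin a) :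
    Matrix (Wire n a → Bool) (Wire n a → Bool) ℂ :=
  Matrix.of fun x y =>
    if ∀ p, x (Sum.inr p) = y (Sum.inr p) then
      (if x (Sum.inr q) = true then A.1 else 1)
        (fun i => x (Sum.inl i)) (fun i => y (Sum.inl i))
    else 0

/-- Quantum circuits on `n` data qubits and `a` ancillas with access to `l` state preparation
routines. The routines occur only as symbols, so a circuit cannot depend on the states that they
prepare. -/
inductive Circuit (n a l : ℕ) : Type
  /-- an arbitrary gate on at most three qubits -/
  | gate (S : Finset (Wire n a)) (hS : S.card ≤ 3) (u : Unitary S)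
  /-- the `j`-th preparation routine, controlled by an ancilla -/
  | prep (j : Fin l) (q : Fin a)
  /-- the inverse of the `j`-th preparation routine, controlled by an ancilla -/
  | prepInv (j : Fin l) (q : Fin a)
  /-- first `c`, then `d` -/
  | seq (c d : Circuit n a l)
  /-- the power with exponent `r ∈ [0, 1]` of the circuit `c`, implemented to accuracy `δ` -/
  | frac (c : Circuit n a l) (r : ℝ) (hr : 0 ≤ r ∧ r ≤ 1) (δ : ℝ) (hδ : 0 < δ ∧ δ ≤ 1)

/-- Running time: a gate takes time `1`, a call of a preparation routine takes time `Tin` (the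
largest of their running times), and if `c` takes time `C`, then a fractional power of `c` to
accuracy `δ` takes time `κ * C / δ`. -/
noncomputable def Circuit.time {n a l : ℕ} (κ Tin : ℝ) : Circuit n a l → ℝ
  | .gate _ _ _ => 1
  | .prep _ _ => Tin
  | .prepInv _ _ => Tin
  | .seq c d => c.time κ Tin + d.time κ Tin
  | .frac c _ _ δ _ => κ * c.time κ Tin / δ

/-- `Implements A c V`: with the preparation routines `A`, the unitary `V` is a possible action of
the circuit `c`. All steps are exact, except that a fractional power to accuracy `δ` may act as any
unitary within operator-norm distance `δ` of the true power. -/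
inductive Implements {n a l : ℕ} (A : Fin l → Unitary (Fin n)) :
    Circuit n a l → Unitary (Wire n a) → Prop
  | gate (S : Finset (Wire n a)) (hS : S.card ≤ 3) (u : Unitary S) (V : Unitary (Wire n a))
      (hV : V.1 = gateMatrix S u) : Implements A (.gate S hS u) V
  | prep (j : Fin l) (q : Fin a) (V : Unitary (Wire n a))
      (hV : V.1 = controlledMatrix (A j) q) : Implements A (.prep j q) V
  | prepInv (j : Fin l) (q : Fin a) (V : Unitary (Wire n a))
      (hV : V.1 = controlledMatrix (A j)⁻¹ q) : Implements A (.prepInv j q) V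
  | seq (c d : Circuit n a l) (V W : Unitary (Wire n a))
      (hc : Implements A c V) (hd : Implements A d W) : Implements A (.seq c d) (W * V)
  | frac (c : Circuit n a l) (r : ℝ) (hr : 0 ≤ r ∧ r ≤ 1) (δ : ℝ) (hδ : 0 < δ ∧ δ ≤ 1)
      (U V : Unitary (Wire n a)) (hc : Implements A c U)
      (hV : ‖op V.1 - fracPower U r‖ ≤ δ) : Implements A (.frac c r hr δ hδ) V

section Consistency

open scoped Kronecker

theorem gateMatrix_mem {n a : ℕ} (S : Finset (Wire n a)) (u : Unitary S) :
    gateMatrix S u ∈ Matrix.unitaryGroup (Wire n a → Bool) ℂ := by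
  have key : gateMatrix S u = Matrix.reindexAlgEquiv ℂ ℂ
      (Equiv.piEquivPiSubtypeProd (fun i => i ∈ S) (fun _ => Bool)).symm
      ((u.1 : Matrix _ _ ℂ) ⊗ₖ
        (1 : Matrix ({i // i ∉ S} → Bool) ({i // i ∉ S} → Bool) ℂ)) := by
    ext x y
    simp only [gateMatrix, Matrix.of_apply, Matrix.coe_reindexAlgEquiv, Matrix.reindex_apply,
      Matrix.submatrix_apply, Equiv.symm_symm, Matrix.kroneckerMap_apply, Matrix.one_apply,
      Equiv.piEquivPiSubtypeProd_apply, funext_iff, Subtype.forall]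
    split_ifs <;> simp
  have h := Matrix.kronecker_mem_unitary u.2
    (one_mem (Matrix.unitaryGroup ({i // i ∉ S} → Bool) ℂ))
  rw [Matrix.mem_unitaryGroup_iff] at h ⊢
  rw [key, Matrix.star_eq_conjTranspose, Matrix.coe_reindexAlgEquiv, Matrix.conjTranspose_reindex,
    ← Matrix.coe_reindexAlgEquiv ℂ ℂ, ← map_mul,
    ← Matrix.star_eq_conjTranspose, h, map_one]

theorem controlledMatrix_mem {n a : ℕ} (A : Unitary (Fin n)) (q : Fin a) :
    controlledMatrix A q ∈ Matrix.unitaryGroup (Wire n a → Bool) ℂ := by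
  have key : controlledMatrix A q = Matrix.reindexAlgEquiv ℂ ℂ
      (Equiv.sumArrowEquivProdArrow (Fin n) (Fin a) Bool).symm
      (Matrix.blockDiagonal fun b : Fin a → Bool =>
        if b q = true then (A.1 : Matrix _ _ ℂ) else 1) := by
    ext x y
    simp only [controlledMatrix, Matrix.of_apply, Matrix.coe_reindexAlgEquiv,
      Matrix.reindex_apply, Matrix.submatrix_apply, Equiv.symm_symm, Matrix.blockDiagonal_apply,
      Equiv.sumArrowEquivProdArrow, Equiv.coe_fn_mk, funext_iff, Function.comp]
    rfl
  rw [Matrix.mem_unitaryGroup_iff]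
  rw [key, Matrix.star_eq_conjTranspose, Matrix.coe_reindexAlgEquiv, Matrix.conjTranspose_reindex,
    ← Matrix.coe_reindexAlgEquiv ℂ ℂ, ← map_mul,
    Matrix.blockDiagonal_conjTranspose, ← Matrix.blockDiagonal_mul]
  have : (fun b : Fin a → Bool => (if b q = true then (A.1 : Matrix _ _ ℂ) else 1) *
      (if b q = true then (A.1 : Matrix _ _ ℂ) else 1).conjTranspose) = 1 := by
    funext b
    have hA := Matrix.mem_unitaryGroup_iff.1 A.2
    rw [Matrix.star_eq_conjTranspose] at hA
    split_ifs
    · exact hA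
    · simp
  rw [this, Matrix.blockDiagonal_one, map_one]

theorem op_unitary {ι : Type} [Fintype ι] [DecidableEq ι] (U : Unitary ι) :
    op U.1 ∈ unitary (Operator ι) :=
  Unitary.map_mem (Matrix.toEuclideanCLM (n := ι → Bool) (𝕜 := ℂ)) U.2

theorem spec_finite {ι : Type} [Fintype ι] [DecidableEq ι] (T : Operator ι) :
    (spectrum ℂ T).Finite := by
  have := Module.End.finite_spectrum (K := ℂ) (T : State ι →ₗ[ℂ] State ι)
  refine this.subset ?_
  exact (AlgHom.spectrum_apply_subset
    ((Module.End.toContinuousLinearMap (State ι) (𝕜 := ℂ)).toAlgHom : _ →ₐ[ℂ] Operator ι)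
    (T : State ι →ₗ[ℂ] State ι))

theorem fracPower_mem {ι : Type} [Fintype ι] [DecidableEq ι] (U : Unitary ι) (r : ℝ) :
    fracPower U r ∈ unitary (Operator ι) := by
  have hn : IsStarNormal (op U.1) := by
    have := op_unitary U
    exact ⟨by rw [commute_iff_eq, (Unitary.mem_iff.1 this).1, (Unitary.mem_iff.1 this).2]⟩
  rw [fracPower, cfc_unitary_iff _ _ hn ((spec_finite _).continuousOn _)]
  intro x hx
  have h1 : ‖x‖ = 1 := by
    have := spectrum.subset_circle_of_unitary (op_unitary U) hx
    simpa using this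
  have : ‖x ^ (r : ℂ)‖ = 1 := by
    rw [Complex.norm_cpow_of_ne_zero (by rintro rfl; simp at h1)]; simp [h1]
  simp only [RCLike.star_def]
  rw [Complex.conj_mul', this]; simp

/-- Every circuit is implemented by some unitary. -/
theorem exists_implements {n a l : ℕ} (A : Fin l → Unitary (Fin n)) (c : Circuit n a l) :
    ∃ V, Implements A c V := by
  induction c with
  | gate S hS u => exact ⟨⟨_, gateMatrix_mem S u⟩, .gate _ _ _ _ rfl⟩
  | prep j q => exact ⟨⟨_, controlledMatrix_mem (A j) q⟩, .prep _ _ _ rfl⟩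
  | prepInv j q => exact ⟨⟨_, controlledMatrix_mem (A j)⁻¹ q⟩, .prepInv _ _ _ rfl⟩
  | seq c d hc hd =>
    obtain ⟨V, hV⟩ := hc
    obtain ⟨W, hW⟩ := hd
    exact ⟨_, .seq _ _ _ _ hV hW⟩
  | frac c r hr δ hδ hc =>
    obtain ⟨U, hU⟩ := hc
    have hm := Unitary.map_mem
      (Matrix.toEuclideanCLM (n := Wire n a → Bool) (𝕜 := ℂ)).symm (fracPower_mem U r)
    refine ⟨⟨_, hm⟩, .frac _ _ _ _ _ U _ hU ?_⟩
    have : op ((Matrix.toEuclideanCLM (n := Wire n a → Bool) (𝕜 := ℂ)).symm (fracPower U r))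
      = fracPower U r := StarAlgEquiv.apply_symm_apply _ _
    simp only [this, sub_self, norm_zero]
    exact hδ.1.le

end Consistency

end QCircuit

namespace QCircuit

/-! ### Unitaries on qubit states; the half power of a rotation -/

section Basic

variable {ι : Type} [Fintype ι] [DecidableEq ι]

/-! A circuit without fractional powers prepares a unit vector `ψ` whose component with vanishing
ancillas is `w • v`, with `w > 0` (`run_combine_ket0_apply`). Its length `p = w * ‖v‖` may be tiny.
Let `R` be the product of the reflection about `ψ` and the reflection about the states with
vanishing ancillas. Then `R` sends `ψ` to its mirror image in the line of `v ⊗ |0…0⟩`: it rotates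
`ψ` by `2θ`, where `cos θ = p`. Since `p > 0`, the angle `2θ` is less than `π`, so the principal
root of `R` rotates by `θ` and takes `ψ` exactly to the normalized target (`fracPower_half_apply`,
`fracPower_amplifier_apply`). The size of `p` changes only the angle, not the cost, so a single half
power replaces iterated amplification.

Everything inside the half power is exact, so its accuracy `ε` is the only error
(`Implements.norm_sub_le`). The time is `O(Tin * l / ε)` (`time_lcuCircuit_le`), which for `l ≥ 2`
lies below the claimed bound (`le_rpow_logb`). For `l = 1` that bound does not involve `ε`, and the
state is prepared exactly without a fractional power. -/

theorem op_apply (M : Matrix (ι → Bool) (ι → Bool) ℂ) (Φ : State ι) (x : ι → Bool) :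
    op M Φ x = ∑ y, M x y * Φ y := by
  rfl

theorem op_mul_apply (M N : Matrix (ι → Bool) (ι → Bool) ℂ) (Φ : State ι) :
    op (M * N) Φ = op M (op N Φ) := by
  simp [op, map_mul]

theorem op_inv_apply_op (U : Unitary ι) (Φ : State ι) : op U⁻¹.1 (op U.1 Φ) = Φ := by
  rw [← op_mul_apply]
  have : (U⁻¹.1 * U.1 : Matrix _ _ ℂ) = 1 := by
    have := inv_mul_cancel U
    exact congrArg Subtype.val this
  rw [this]; simp [op]

theorem op_apply_op_inv (U : Unitary ι) (Φ : State ι) : op U.1 (op U⁻¹.1 Φ) = Φ := by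
  simpa using op_inv_apply_op U⁻¹ Φ

theorem norm_op_apply (U : Unitary ι) (Φ : State ι) : ‖op U.1 Φ‖ = ‖Φ‖ :=
  ContinuousLinearMap.norm_map_of_mem_unitary (op_unitary U) Φ

theorem inner_op_apply (U : Unitary ι) (Φ Ψ : State ι) :
    inner ℂ (op U.1 Φ) (op U.1 Ψ) = inner ℂ Φ Ψ :=
  ContinuousLinearMap.inner_map_map_of_mem_unitary (op_unitary U) Φ Ψ

theorem ket0_apply (x : ι → Bool) : ket0 ι x = if ∀ i, x i = false then 1 else 0 := by
  simp [ket0, funext_iff]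

theorem norm_ket0 : ‖ket0 ι‖ = 1 := by
  simp [ket0]

/-- If `U` acts on the cyclic subspace of `ψ` as a rotation by an angle in `(-π, π)`, then the
square root of `U` acts on `ψ` as the rotation by half that angle. -/
theorem fracPower_half_apply (U : Unitary ι) (ψ : State ι) (p : ℝ) (hp : 0 < p)
    (h : op U.1 (op U.1 ψ) + ψ = (2 * (2 * p ^ 2 - 1) : ℂ) • op U.1 ψ) :
    fracPower U (1 / 2) ψ = (1 / (2 * p) : ℂ) • (ψ + op U.1 ψ) := by
  set T := op U.1 with hT
  have hn : IsStarNormal T := by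
    have := op_unitary U
    exact ⟨by rw [commute_iff_eq, (Unitary.mem_iff.1 this).1, (Unitary.mem_iff.1 this).2]⟩
  have hc : ∀ f : ℂ → ℂ, ContinuousOn f (spectrum ℂ T) := fun f => (spec_finite T).continuousOn f
  have hpc : (p : ℂ) ≠ 0 := by exact_mod_cast hp.ne'
  -- The hypothesis says that `q` of `T` annihilates `ψ`. At the roots of `q` one has `(1 + z) ^ 2 =
  -- 4 * p ^ 2 * z`, so `g` is a square root there. Thus the principal root is `g` modulo `q`; the
  -- value of the quotient `k` at a root of `q` is irrelevant.
  let q : ℂ → ℂ := fun z => z * z + 1 - 2 * (2 * p ^ 2 - 1) * z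
  let g : ℂ → ℂ := fun z => 1 / (2 * p) * (1 + z)
  let k : ℂ → ℂ := fun z => (z ^ (((1 / 2 : ℝ)) : ℂ) - g z) / q z
  have hroot : ∀ z ∈ spectrum ℂ T, z ^ (((1 / 2 : ℝ)) : ℂ) = g z + k z * q z := by
    intro z hz
    by_cases hq : q z = 0
    · have hz1 : ‖z‖ = 1 := by
        have := spectrum.subset_circle_of_unitary (op_unitary U) hz
        simpa using this
      have hre : z.re = 2 * p ^ 2 - 1 := by
        have h1 : z * star z = 1 := by
          have := Complex.mul_conj' z
          rw [hz1] at this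
          simpa using this
        have h2 : z + star z = ((2 * (2 * p ^ 2 - 1) : ℝ) : ℂ) := by
          have : star z * q z = 0 := by rw [hq, mul_zero]
          simp only [q] at this
          push_cast
          linear_combination this + (2 * (2 * (p : ℂ) ^ 2 - 1) - z) * h1
        have h3 := congrArg Complex.re h2
        simp only [Complex.add_re, Complex.ofReal_re, RCLike.star_def, Complex.conj_re] at h3
        linarith
      have hg : g z ^ 2 = z := by
        simp only [g, q] at hq ⊢
        field_simp
        linear_combination hq
      -- The real part is `p`; its positivity singles out `g z` as the principal root.
      have hgre : 0 < (g z).re := by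
        have : g z = ((1 / (2 * p) : ℝ) : ℂ) * (1 + z) := by simp [g]
        rw [this, Complex.re_ofReal_mul, Complex.add_re, hre, Complex.one_re]
        have : 1 + (2 * p ^ 2 - 1) = 2 * p ^ 2 := by ring
        rw [this]; positivity
      have : z ^ (((1 / 2 : ℝ)) : ℂ) = g z := by
        conv_lhs => rw [← hg]
        have := Complex.sq_cpow_two_inv hgre
        simpa using this
      rw [this, hq]; simp
    · simp only [k]; field_simp; ring
  have e1 : fracPower U (1 / 2) = cfc g T + cfc k T * cfc q T := by
    rw [fracPower, ← hT, ← cfc_mul k q T (hc _) (hc _),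
      ← cfc_add (a := T) g (fun z => k z * q z) (hc _) (hc _)]
    exact cfc_congr hroot
  have e2 : cfc q T = T * T + 1 - (2 * (2 * p ^ 2 - 1) : ℂ) • T := by
    have := cfc_sub (a := T) (fun z : ℂ => z * z + 1) (fun z => 2 * (2 * (p : ℂ) ^ 2 - 1) * z)
      (hc _) (hc _)
    simp only [q]
    rw [this, cfc_add (a := T) (fun z : ℂ => z * z) (fun _ => 1) (hc _) (hc _),
      cfc_mul (fun z : ℂ => z) (fun z : ℂ => z) T (hc _) (hc _), cfc_const_mul_id _ T,
      cfc_id' ℂ T, cfc_const_one ℂ T]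
  have e3 : cfc g T = (1 / (2 * p) : ℂ) • (1 + T) := by
    simp only [g]
    rw [cfc_const_mul (1 / (2 * p) : ℂ) (fun z => 1 + z) T (hc _),
      cfc_add (a := T) (fun _ : ℂ => 1) (fun z => z) (hc _) (hc _), cfc_id' ℂ T, cfc_const_one ℂ T]
  have e4 : (cfc q T) ψ = 0 := by
    rw [e2]
    change T (T ψ) + ψ - (2 * (2 * p ^ 2 - 1) : ℂ) • T ψ = 0
    rw [h, sub_self]
  rw [e1, e3]
  change (1 / (2 * p) : ℂ) • (ψ + T ψ) + cfc k T (cfc q T ψ) = _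
  rw [e4, map_zero, add_zero]

/-- The operator that acts on qubit `t` by the one-qubit gate `u x`, where `x` is the current
basis state. -/
def multiplexed (t : ι) (u : (ι → Bool) → Matrix.unitaryGroup Bool ℂ) :
    Matrix (ι → Bool) (ι → Bool) ℂ :=
  Matrix.of fun x y => if ∀ i, i ≠ t → x i = y i then (u x).1 (x t) (y t) else 0

theorem sum_eq_off (t : ι) (x : ι → Bool) (F : (ι → Bool) → ℂ) :
    (∑ y, if ∀ i, i ≠ t → x i = y i then F y else 0) =
      ∑ b, F (Function.update x t b) := by
  rw [← Finset.sum_filter]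
  symm
  refine Finset.sum_bij (fun b _ => Function.update x t b) ?_ ?_ ?_ ?_
  · intro b _
    simp only [Finset.mem_filter, Finset.mem_univ, true_and]
    intro i hi
    simp [hi]
  · intro b _ c _ h
    simpa using congrFun h t
  · intro y hy
    refine ⟨y t, Finset.mem_univ _, ?_⟩
    simp only [Finset.mem_filter, Finset.mem_univ, true_and] at hy
    funext i
    by_cases hi : i = t
    · subst hi; simp
    · simp [hi, hy i hi]
  · simp

/-- Fixing all qubits except `t` cuts the matrix into two-by-two blocks; `hu` makes `u` constant on
each block. -/
theorem multiplexed_mem (t : ι) (u : (ι → Bool) → Matrix.unitaryGroup Bool ℂ)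
    (hu : ∀ x b, u (Function.update x t b) = u x) :
    multiplexed t u ∈ Matrix.unitaryGroup (ι → Bool) ℂ := by
  rw [Matrix.mem_unitaryGroup_iff]
  ext x z
  simp only [Matrix.mul_apply, Matrix.star_apply, multiplexed, Matrix.of_apply, ite_mul, zero_mul]
  rw [sum_eq_off]
  by_cases h : ∀ i, i ≠ t → z i = x i
  · have hz : z = Function.update x t (z t) := by
      funext i
      by_cases hi : i = t
      · subst hi; simp
      · simp [hi, h i hi]
    have hc : ∀ b, ∀ i, i ≠ t → z i = Function.update x t b i := by
      intro b i hi; simp [hi, h i hi]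
    have huz : u z = u x := by rw [hz, hu]
    have hxz : x = z ↔ x t = z t := by
      refine ⟨fun e => by rw [e], fun e => ?_⟩
      rw [hz, ← e]; simp
    have := congrFun (congrFun (Matrix.mem_unitaryGroup_iff.1 (u x).2) (x t)) (z t)
    simp only [Matrix.mul_apply, Matrix.star_apply] at this
    simp only [if_pos (hc _), huz, Function.update_self, this, Matrix.one_apply, hxz]
  · have hc : ∀ b, ¬ ∀ i, i ≠ t → z i = Function.update x t b i := by
      intro b h'
      exact h fun i hi => by simpa [hi] using h' i hi
    have hxz : x ≠ z := fun e => h (by simp [e])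
    simp only [if_neg (hc _)]
    simp [hxz]

theorem op_multiplexed_apply (t : ι) (u : (ι → Bool) → Matrix.unitaryGroup Bool ℂ)
    (Φ : State ι) (x : ι → Bool) :
    op (multiplexed t u) Φ x = ∑ b, (u x).1 (x t) b * Φ (Function.update x t b) := by
  rw [op_apply]
  simp only [multiplexed, Matrix.of_apply, ite_mul, zero_mul]
  rw [sum_eq_off]
  simp

end Basic

/-! ### Exact circuits: action, inverses, multiplexed gates, untouched ancillas -/

section Semantics

variable {n a l : ℕ}

/-- The action of a circuit without fractional powers. -/
noncomputable def Circuit.sem (A : Fin l → Unitary (Fin n)) :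
    Circuit n a l → Unitary (Wire n a)
  | .gate S _ u => ⟨gateMatrix S u, gateMatrix_mem S u⟩
  | .prep j q => ⟨controlledMatrix (A j) q, controlledMatrix_mem (A j) q⟩
  | .prepInv j q => ⟨controlledMatrix (A j)⁻¹ q, controlledMatrix_mem (A j)⁻¹ q⟩
  | .seq c d => d.sem A * c.sem A
  | .frac _ _ _ _ _ => 1

/-- Circuits without fractional powers. -/
def Circuit.IsExact : Circuit n a l → Prop
  | .seq c d => c.IsExact ∧ d.IsExact
  | .frac _ _ _ _ _ => False
  | _ => True

/-- The inverse of a circuit without fractional powers. -/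
noncomputable def Circuit.inv : Circuit n a l → Circuit n a l
  | .gate S hS u => .gate S hS u⁻¹
  | .prep j q => .prepInv j q
  | .prepInv j q => .prep j q
  | .seq c d => .seq d.inv c.inv
  | c => c

theorem Circuit.IsExact.inv {c : Circuit n a l} (hc : c.IsExact) : c.inv.IsExact := by
  induction c with
  | seq c d ihc ihd => exact ⟨ihd hc.2, ihc hc.1⟩
  | frac => exact hc.elim
  | _ => trivial

theorem Circuit.time_inv (κ Tin : ℝ) (c : Circuit n a l) :
    c.inv.time κ Tin = c.time κ Tin := by
  induction c with
  | seq c d ihc ihd => simp only [Circuit.inv, Circuit.time, ihc, ihd, add_comm]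
  | _ => rfl

/-- Only fractional powers leave any freedom in the outcome; the dummy value of `sem` on them is
never reached. -/
theorem Implements.eq_sem {A : Fin l → Unitary (Fin n)} {c : Circuit n a l}
    (hc : c.IsExact) {V : Unitary (Wire n a)} (h : Implements A c V) : V = c.sem A := by
  induction h with
  | gate S hS u V hV => exact Subtype.ext hV
  | prep j q V hV => exact Subtype.ext hV
  | prepInv j q V hV => exact Subtype.ext hV
  | seq c d V W _ _ ihc ihd => rw [ihc hc.1, ihd hc.2]; rfl
  | frac => exact hc.elim

theorem gateMatrix_inv (S : Finset (Wire n a)) (u : Unitary S) :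
    gateMatrix S u⁻¹ = star (gateMatrix S u) := by
  ext x y
  have : ((u⁻¹ : Unitary S).1 : Matrix _ _ ℂ) = star u.1 := rfl
  simp only [gateMatrix, Matrix.of_apply, Matrix.star_apply, this, eq_comm (a := y _)]
  split_ifs <;> simp

theorem controlledMatrix_inv (A : Unitary (Fin n)) (q : Fin a) :
    controlledMatrix A⁻¹ q = star (controlledMatrix A q) := by
  ext x y
  have : ((A⁻¹ : Unitary (Fin n)).1 : Matrix _ _ ℂ) = star A.1 := rfl
  simp only [controlledMatrix, Matrix.of_apply, Matrix.star_apply, this]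
  by_cases h : ∀ p, x (.inr p) = y (.inr p)
  · rw [if_pos h, if_pos fun p => (h p).symm, ← h q]
    split_ifs
    · simp
    · simp only [Matrix.one_apply, eq_comm (a := fun i => y (Sum.inl i))]
      split_ifs <;> simp
  · rw [if_neg h, if_neg fun h' => h fun p => (h' p).symm]; simp

theorem Circuit.sem_inv (A : Fin l → Unitary (Fin n)) {c : Circuit n a l} (hc : c.IsExact) :
    c.inv.sem A = (c.sem A)⁻¹ := by
  induction c with
  | gate S hS u => exact Subtype.ext (gateMatrix_inv S u)
  | prep j q => exact Subtype.ext (controlledMatrix_inv (A j) q)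
  | prepInv j q =>
    refine Subtype.ext ?_
    have := controlledMatrix_inv (A j)⁻¹ q
    rwa [inv_inv] at this
  | seq c d ihc ihd => simp only [Circuit.inv, Circuit.sem, ihc hc.1, ihd hc.2, mul_inv_rev]
  | frac => exact hc.elim

/-- The state obtained by applying a circuit without fractional powers to `Φ`. -/
noncomputable def Circuit.run (A : Fin l → Unitary (Fin n)) (c : Circuit n a l)
    (Φ : State (Wire n a)) : State (Wire n a) := op (c.sem A).1 Φ

theorem run_seq (A : Fin l → Unitary (Fin n)) (c d : Circuit n a l) (Φ : State (Wire n a)) :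
    (Circuit.seq c d).run A Φ = d.run A (c.run A Φ) :=
  op_mul_apply _ _ _

theorem run_inv_run (A : Fin l → Unitary (Fin n)) {c : Circuit n a l} (hc : c.IsExact)
    (Φ : State (Wire n a)) : c.inv.run A (c.run A Φ) = Φ := by
  rw [Circuit.run, Circuit.sem_inv A hc]; exact op_inv_apply_op _ _

theorem run_run_inv (A : Fin l → Unitary (Fin n)) {c : Circuit n a l} (hc : c.IsExact)
    (Φ : State (Wire n a)) : c.run A (c.inv.run A Φ) = Φ := by
  rw [Circuit.run, Circuit.run, Circuit.sem_inv A hc]; exact op_apply_op_inv _ _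

theorem op_controlledMatrix_apply (A : Unitary (Fin n)) (q : Fin a) (Φ : State (Wire n a))
    (x : Wire n a → Bool) :
    op (controlledMatrix A q) Φ x = if x (.inr q) = true then
      ∑ d, A.1 (fun i => x (.inl i)) d * Φ (Sum.elim d fun p => x (.inr p)) else Φ x := by
  rw [op_apply, ← (Equiv.sumArrowEquivProdArrow (Fin n) (Fin a) Bool).symm.sum_comp,
    Fintype.sum_prod_type]
  simp only [controlledMatrix, Matrix.of_apply, Equiv.sumArrowEquivProdArrow, Equiv.coe_fn_symm_mk,
    Sum.elim_inr, Sum.elim_inl, ← funext_iff (f := fun p => x (Sum.inr p)), ite_mul, zero_mul,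
    Finset.sum_ite_eq, Finset.mem_univ, if_true]
  split_ifs with h
  · rfl
  · simp only [Matrix.one_apply, ite_mul, one_mul, zero_mul, Finset.sum_ite_eq, Finset.mem_univ,
      if_true]
    refine congrArg Φ.ofLp ?_
    funext i
    cases i <;> rfl

theorem run_prep_apply (A : Fin l → Unitary (Fin n)) (j : Fin l) (q : Fin a)
    (Φ : State (Wire n a)) (x : Wire n a → Bool) :
    (Circuit.prep j q).run A Φ x = if x (.inr q) = true then
      ∑ d, (A j).1 (fun i => x (.inl i)) d * Φ (Sum.elim d fun p => x (.inr p)) else Φ x :=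
  op_controlledMatrix_apply _ _ _ _

/-- The gate that acts on the qubit `t` by a one-qubit gate depending on the qubits `p` and `q`
(a control that equals `t` is read as `0`). -/
noncomputable def mux (p q t : Wire n a) (u : Bool → Bool → Matrix.unitaryGroup Bool ℂ) :
    Circuit n a l :=
  .gate {p, q, t} Finset.card_le_three
    -- Resetting `t` before reading the controls makes the chosen gate independent of `t`, so wires
    -- may coincide and one- and two-qubit gates are included.
    ⟨multiplexed (ι := ({p, q, t} : Finset (Wire n a))) ⟨t, by simp⟩ fun x =>
      u (Function.update x ⟨t, by simp⟩ false ⟨p, by simp⟩)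
        (Function.update x ⟨t, by simp⟩ false ⟨q, by simp⟩),
      multiplexed_mem _ _ fun x b => by simp⟩

theorem time_mux (κ Tin : ℝ) (p q t : Wire n a)
    (u : Bool → Bool → Matrix.unitaryGroup Bool ℂ) :
    (mux p q t u : Circuit n a l).time κ Tin = 1 := rfl

theorem run_mux_apply (A : Fin l → Unitary (Fin n)) (p q t : Wire n a)
    (u : Bool → Bool → Matrix.unitaryGroup Bool ℂ) (Φ : State (Wire n a)) (x : Wire n a → Bool) :
    (mux p q t u).run A Φ x =
      ∑ b, (u (Function.update x t false p) (Function.update x t false q)).1 (x t) b *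
        Φ (Function.update x t b) := by
  rw [← op_multiplexed_apply t
    (fun x => u (Function.update x t false p) (Function.update x t false q))]
  have key : ((mux p q t u : Circuit n a l).sem A).1 = multiplexed t
      (fun x => u (Function.update x t false p) (Function.update x t false q)) := by
    ext x y
    simp only [mux, Circuit.sem, gateMatrix, multiplexed, Matrix.of_apply, ← ite_and]
    refine if_congr ?_ ?_ rfl
    · constructor
      · rintro ⟨h1, h2⟩ i hi
        by_cases hS : i ∈ ({p, q, t} : Finset (Wire n a))
        · exact h2 ⟨i, hS⟩ (by simpa [Subtype.ext_iff] using hi)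
        · exact h1 i hS
      · refine fun h => ⟨fun i hi => h i ?_, fun i hi => h i.1 ?_⟩
        · rintro rfl; simp at hi
        · intro e; exact hi (Subtype.ext e)
    · simp only [Function.update_apply, Subtype.mk.injEq]
  rw [Circuit.run, key]

/-- The circuit `c` does not act on the qubit `w`, except by using it as a control. -/
def Circuit.Avoids (w : Fin a) : Circuit n a l → Prop
  | .gate S _ _ => Sum.inr w ∉ S
  | .prep _ _ => True
  | .prepInv _ _ => True
  | .seq c d => c.Avoids w ∧ d.Avoids w
  | .frac _ _ _ _ _ => False

theorem Circuit.Avoids.inv {w : Fin a} {c : Circuit n a l} (hc : c.Avoids w) :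
    c.inv.Avoids w := by
  induction c with
  | seq c d ihc ihd => exact ⟨ihd hc.2, ihc hc.1⟩
  | frac => exact hc.elim
  | gate => exact hc
  | _ => trivial

theorem op_controlledMatrix_support (A : Unitary (Fin n)) (q w : Fin a) (Φ : State (Wire n a))
    (hΦ : ∀ x, x (.inr w) = true → Φ x = 0) (x : Wire n a → Bool) (hx : x (.inr w) = true) :
    op (controlledMatrix A q) Φ x = 0 := by
  rw [op_controlledMatrix_apply]
  split_ifs
  · exact Finset.sum_eq_zero fun d _ => by rw [hΦ _ (by simpa using hx), mul_zero]
  · exact hΦ x hx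

/-- A controlled call never changes its control, and a gate away from `w` preserves the value of
`w`. This keeps the work qubits clean for the reflections. -/
theorem Circuit.Avoids.run_support {w : Fin a} {c : Circuit n a l} (hc : c.Avoids w)
    (A : Fin l → Unitary (Fin n)) (Φ : State (Wire n a))
    (hΦ : ∀ x, x (.inr w) = true → Φ x = 0) :
    ∀ x, x (.inr w) = true → c.run A Φ x = 0 := by
  induction c generalizing Φ with
  | gate S hS u =>
    intro x hx
    change op (gateMatrix S u) Φ x = 0
    rw [op_apply]
    refine Finset.sum_eq_zero fun y _ => ?_
    simp only [gateMatrix, Matrix.of_apply]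
    split_ifs with h
    · rw [hΦ y (by rw [← h _ hc, hx]), mul_zero]
    · rw [zero_mul]
  | prep j q => exact op_controlledMatrix_support _ _ _ _ hΦ
  | prepInv j q => exact op_controlledMatrix_support _ _ _ _ hΦ
  | seq c d ihc ihd => rw [run_seq]; exact ihd hc.2 _ (ihc hc.1 _ hΦ)
  | frac => exact hc.elim

theorem mux_avoids (w : Fin a) (p q t : Wire n a)
    (u : Bool → Bool → Matrix.unitaryGroup Bool ℂ) (hp : .inr w ≠ p) (hq : .inr w ≠ q)
    (ht : .inr w ≠ t) : (mux p q t u : Circuit n a l).Avoids w := by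
  simp [mux, Circuit.Avoids, hp, hq, ht]

end Semantics

/-! ### One-qubit gates -/

section OneQubit

/-- The one-qubit gate with matrix `!![c, -z * conj d; d, z * conj c]`. -/
noncomputable def oneQubit (z c d : ℂ) (hz : ‖z‖ = 1) (h : ‖c‖ ^ 2 + ‖d‖ ^ 2 = 1) :
    Matrix.unitaryGroup Bool ℂ :=
  ⟨Matrix.of fun a b => if a = true then (if b = true then z * star c else d)
      else (if b = true then -(z * star d) else c), by
    have hz' : z * star z = 1 := by
      have := Complex.mul_conj' z
      rw [hz] at this
      simpa using this
    have h' : c * star c + d * star d = 1 := by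
      have e1 := Complex.mul_conj' c
      have e2 := Complex.mul_conj' d
      simp only [RCLike.star_def]
      rw [e1, e2]
      exact_mod_cast h
    rw [Matrix.mem_unitaryGroup_iff]
    ext a b
    cases a <;> cases b <;>
      simp only [Matrix.mul_apply, Matrix.star_apply, Matrix.of_apply, Fintype.sum_bool,
        Matrix.one_apply, star_mul', star_neg, star_star, if_true, if_false, reduceCtorEq]
    · linear_combination h' + d * star d * hz'
    · linear_combination -(c * star d) * hz'
    · linear_combination -(star c * d) * hz'
    · linear_combination h' + c * star c * hz'⟩

theorem oneQubit_apply (z c d : ℂ) (hz : ‖z‖ = 1) (h : ‖c‖ ^ 2 + ‖d‖ ^ 2 = 1) (a b : Bool) :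
    (oneQubit z c d hz h).1 a b = if a = true then (if b = true then z * star c else d)
      else (if b = true then -(z * star d) else c) := rfl

/-- The Pauli gate `X`. -/
noncomputable def pauliX : Matrix.unitaryGroup Bool ℂ := oneQubit (-1) 0 1 (by simp) (by simp)

/-- The Pauli gate `Z`. -/
noncomputable def pauliZ : Matrix.unitaryGroup Bool ℂ := oneQubit (-1) 1 0 (by simp) (by simp)

end OneQubit

/-! ### Multi-controlled sign flips from three-qubit gates -/

section Ladder

variable {n a l : ℕ}

theorem run_mux_ite_pauliX (A : Fin l → Unitary (Fin n)) (p q t : Wire n a) (hp : p ≠ t)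
    (hq : q ≠ t) (f : Bool → Bool → Bool) (Φ : State (Wire n a)) (x : Wire n a → Bool) :
    (mux p q t fun b c => if f b c = true then pauliX else 1).run A Φ x =
      if f (x p) (x q) = true then Φ (Function.update x t (!x t)) else Φ x := by
  rw [run_mux_apply]
  simp only [Function.update_of_ne hp, Function.update_of_ne hq, Fintype.sum_bool]
  split_ifs
  · cases hx : x t <;> simp [pauliX, oneQubit_apply]
  · cases hx : x t
    · have : Function.update x t false = x := by rw [← hx, Function.update_eq_self]
      simp [this]
    · have : Function.update x t true = x := by rw [← hx, Function.update_eq_self]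
      simp [this]

theorem run_mux_pauliX (A : Fin l → Unitary (Fin n)) (t : Wire n a) (Φ : State (Wire n a))
    (x : Wire n a → Bool) :
    (mux t t t fun _ _ => pauliX).run A Φ x = Φ (Function.update x t (!x t)) := by
  rw [run_mux_apply, Fintype.sum_bool]
  cases hx : x t <;> simp [pauliX, oneQubit_apply]

theorem run_mux_pauliZ (A : Fin l → Unitary (Fin n)) (t : Wire n a) (Φ : State (Wire n a))
    (x : Wire n a → Bool) :
    (mux t t t fun _ _ => pauliZ).run A Φ x = if x t = true then -Φ x else Φ x := by
  rw [run_mux_apply, Fintype.sum_bool]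
  cases hx : x t
  · have : Function.update x t false = x := by rw [← hx, Function.update_eq_self]
    simp [pauliZ, oneQubit_apply, this]
  · have : Function.update x t true = x := by rw [← hx, Function.update_eq_self]
    simp [pauliZ, oneQubit_apply, this]

/-- Sets the qubit `t m`, where `m` is the length of `L`, to `1` if all qubits in `L` are `0`,
using the clean work qubits `t 0, …, t m`. -/
noncomputable def ladder (t : ℕ → Wire n a) : List (Wire n a) → Circuit n a l
  | [] => mux (t 0) (t 0) (t 0) fun _ _ => pauliX
  | q :: L => .seq (ladder t L) (mux (t L.length) q (t (L.length + 1))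
      fun b c => if (b && !c) = true then pauliX else 1)

/-- The permutation of the computational basis underlying `ladder`. -/
def ladderMap (t : ℕ → Wire n a) : List (Wire n a) → (Wire n a → Bool) → (Wire n a → Bool)
  | [], x => Function.update x (t 0) (!x (t 0))
  | q :: L, x =>
    if (ladderMap t L x (t L.length) && !ladderMap t L x q) = true then
      Function.update (ladderMap t L x) (t (L.length + 1)) (!ladderMap t L x (t (L.length + 1)))
    else ladderMap t L x

theorem ladder_isExact (t : ℕ → Wire n a) (L : List (Wire n a)) :
    (ladder t L : Circuit n a l).IsExact := by
  induction L with
  | nil => trivial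
  | cons q L ih => exact ⟨ih, trivial⟩

theorem time_ladder (κ Tin : ℝ) (t : ℕ → Wire n a) (L : List (Wire n a)) :
    (ladder t L : Circuit n a l).time κ Tin = L.length + 1 := by
  induction L with
  | nil => simp [ladder, time_mux]
  | cons q L ih => simp [ladder, time_mux, Circuit.time, ih]

/-- Evaluating at the image point avoids inverting the permutation. The distinctness hypotheses keep
the target of each step apart from its controls. -/
theorem run_ladder_ladderMap (A : Fin l → Unitary (Fin n)) (t : ℕ → Wire n a) {m : ℕ}
    (ht : ∀ i j, i < j → j ≤ m → t i ≠ t j) (L : List (Wire n a)) (hm : L.length ≤ m)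
    (hL : ∀ q ∈ L, ∀ i ≤ m, q ≠ t i) (Φ : State (Wire n a)) (x : Wire n a → Bool) :
    (ladder t L).run A Φ (ladderMap t L x) = Φ x := by
  induction L with
  | nil => simp [ladder, ladderMap, run_mux_pauliX]
  | cons q L ih =>
    simp only [List.length_cons] at hm
    have ih' := ih (by omega) fun q' hq' => hL q' (List.mem_cons_of_mem _ hq')
    have h1 := ht L.length (L.length + 1) (by omega) hm
    have h2 := hL q List.mem_cons_self (L.length + 1) hm
    rw [ladder, run_seq, run_mux_ite_pauliX A _ _ _ h1 h2 fun b c => b && !c, ladderMap]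
    by_cases h : (ladderMap t L x (t L.length) && !ladderMap t L x q) = true
    · simp only [if_pos h, Function.update_of_ne h1, Function.update_of_ne h2]
      simp [ih']
    · simp only [if_neg h, ih']

theorem ladderMap_apply_of_ne (t : ℕ → Wire n a) (L : List (Wire n a)) (x : Wire n a → Bool)
    (w : Wire n a) (hw : ∀ i ≤ L.length, w ≠ t i) : ladderMap t L x w = x w := by
  induction L with
  | nil => simp [ladderMap, Function.update_of_ne (hw 0 le_rfl)]
  | cons q L ih =>
    simp only [List.length_cons] at hw
    have := ih fun i hi => hw i (by omega)
    rw [ladderMap]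
    split_ifs
    · rw [Function.update_of_ne (hw _ le_rfl), this]
    · exact this

/-- Starting from clean work qubits, each new one records the conjunction of the previous one with
the negation of one more qubit of the list. -/
theorem ladderMap_apply_length (t : ℕ → Wire n a) {m : ℕ}
    (ht : ∀ i j, i < j → j ≤ m → t i ≠ t j) (L : List (Wire n a)) (hm : L.length ≤ m)
    (hL : ∀ q ∈ L, ∀ i ≤ m, q ≠ t i) (x : Wire n a → Bool) (hx : ∀ i ≤ m, x (t i) = false) :
    ladderMap t L x (t L.length) = true ↔ ∀ q ∈ L, x q = false := by
  induction L with
  | nil => simp [ladderMap, hx]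
  | cons q L ih =>
    simp only [List.length_cons] at hm ⊢
    have ih' := ih (by omega) fun q' hq' => hL q' (List.mem_cons_of_mem _ hq')
    have h1 : ladderMap t L x (t (L.length + 1)) = false := by
      rw [ladderMap_apply_of_ne t L x _ fun i hi => (ht i _ (by omega) hm).symm]
      exact hx _ hm
    have h2 : ladderMap t L x q = x q :=
      ladderMap_apply_of_ne t L x _ fun i hi => hL q List.mem_cons_self i (by omega)
    simp only [List.forall_mem_cons, ← ih', ladderMap, h1, h2]
    by_cases h : (ladderMap t L x (t L.length) && !x q) = true
    · simp only [if_pos h]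
      simp at h
      simp [h]
    · simp only [if_neg h, h1]
      simp only [Bool.and_eq_true, Bool.not_eq_true', not_and, Bool.not_eq_false] at h
      simp only [reduceCtorEq, false_iff, not_and]
      intro hq hl
      simp [h hl] at hq

/-- Changes the sign of the basis states in which all qubits in `L` are `0`. -/
noncomputable def flipZero (t : ℕ → Wire n a) (L : List (Wire n a)) : Circuit n a l :=
  .seq (.seq (ladder t L) (mux (t L.length) (t L.length) (t L.length) fun _ _ => pauliZ))
    (ladder t L).inv

theorem flipZero_isExact (t : ℕ → Wire n a) (L : List (Wire n a)) :
    (flipZero t L : Circuit n a l).IsExact :=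
  ⟨⟨ladder_isExact t L, trivial⟩, (ladder_isExact t L).inv⟩

theorem time_flipZero (κ Tin : ℝ) (t : ℕ → Wire n a) (L : List (Wire n a)) :
    (flipZero t L : Circuit n a l).time κ Tin = 2 * L.length + 3 := by
  simp only [flipZero, Circuit.time, Circuit.time_inv, time_ladder, time_mux]
  ring

theorem run_flipZero_apply (A : Fin l → Unitary (Fin n)) (t : ℕ → Wire n a) {m : ℕ}
    (ht : ∀ i j, i < j → j ≤ m → t i ≠ t j) (L : List (Wire n a)) (hm : L.length ≤ m)
    (hL : ∀ q ∈ L, ∀ i ≤ m, q ≠ t i) (Φ : State (Wire n a))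
    (hΦ : ∀ i ≤ m, ∀ x, x (t i) = true → Φ x = 0) (x : Wire n a → Bool) :
    (flipZero t L).run A Φ x = if ∀ q ∈ L, x q = false then -Φ x else Φ x := by
  have key : (flipZero t L).run A Φ x =
      if ladderMap t L x (t L.length) = true then -Φ x else Φ x := by
    -- One further `ladder` cancels the uncomputation, so the sign is read off the last work qubit
    -- at the image point.
    rw [← run_ladder_ladderMap A t ht L hm hL ((flipZero t L).run A Φ) x, flipZero, run_seq,
      run_run_inv A (ladder_isExact t L), run_seq, run_mux_pauliZ,
      run_ladder_ladderMap A t ht L hm hL]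
  rw [key]
  -- If some work qubit of `x` is `1`, then `Φ x = 0` and the sign is immaterial.
  by_cases hx : ∀ i ≤ m, x (t i) = false
  · simp only [ladderMap_apply_length t ht L hm hL x hx]
  · push Not at hx
    obtain ⟨i, hi, hxi⟩ := hx
    have : Φ x = 0 := hΦ i hi x (by simpa using hxi)
    simp [this]

end Ladder

/-! ### Linear combinations with equal damping of all branches -/

section Combination

variable {n a l : ℕ}

/-- The Hadamard gate. -/
noncomputable def hadamard : Matrix.unitaryGroup Bool ℂ :=
  oneQubit (-1) ((√2)⁻¹ : ℝ) ((√2)⁻¹ : ℝ) (by simp) (by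
    rw [Complex.norm_real, Real.norm_eq_abs, sq_abs, inv_pow, Real.sq_sqrt zero_le_two]; norm_num)

theorem norm_sqrt_one_sub_sq (x : ℝ) (hx : x ≤ 1) : ‖((√(1 - x) : ℝ) : ℂ)‖ ^ 2 + x = 1 := by
  rw [Complex.norm_real, Real.norm_eq_abs, sq_abs, Real.sq_sqrt (by linarith)]; ring

/-- The rotation that maps `|0⟩` to `√(1 - |d|²)|0⟩ + d|1⟩`. -/
noncomputable def loadGate (d : ℂ) (hd : ‖d‖ ^ 2 ≤ 1 / 2) : Matrix.unitaryGroup Bool ℂ :=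
  oneQubit 1 (√(1 - ‖d‖ ^ 2) : ℝ) d (by simp) (norm_sqrt_one_sub_sq _ (by linarith))

/-- A rotation whose `|0⟩⟨0|` entry is `1 / (√2 √(1 - |d|²))`. -/
noncomputable def dampGate (d : ℂ) (hd : ‖d‖ ^ 2 ≤ 1 / 2) : Matrix.unitaryGroup Bool ℂ :=
  oneQubit 1 ((√2)⁻¹ / √(1 - ‖d‖ ^ 2) : ℝ) (√(1 - ((√2)⁻¹ / √(1 - ‖d‖ ^ 2)) ^ 2) : ℝ) (by simp) (by
    have h1 : ((√2)⁻¹ / √(1 - ‖d‖ ^ 2)) ^ 2 ≤ 1 := by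
      rw [div_pow, inv_pow, Real.sq_sqrt zero_le_two, Real.sq_sqrt (by linarith), div_le_one] <;>
        linarith
    rw [add_comm, Complex.norm_real ((√2)⁻¹ / √(1 - ‖d‖ ^ 2)), Real.norm_eq_abs, sq_abs]
    exact norm_sqrt_one_sub_sq _ h1)

/-- The branch in which no state has been chosen must shrink by `1 / √2`, exactly as the Hadamard
gate shrinks the branches with a choice. -/
theorem dampGate_mul_loadGate (d : ℂ) (hd : ‖d‖ ^ 2 ≤ 1 / 2) :
    (dampGate d hd).1 false false * (loadGate d hd).1 false false = ((√2)⁻¹ : ℝ) := by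
  have : √(1 - ‖d‖ ^ 2) ≠ 0 := (Real.sqrt_pos.2 (by linarith)).ne'
  simp only [dampGate, loadGate, oneQubit_apply, reduceCtorEq, if_false]
  rw [← Complex.ofReal_mul, div_mul_cancel₀ _ this]

theorem run_mux_single_apply (A : Fin l → Unitary (Fin n)) (p t : Wire n a) (hp : p ≠ t)
    (u : Bool → Matrix.unitaryGroup Bool ℂ) (Φ : State (Wire n a)) (x : Wire n a → Bool) :
    (mux p p t fun b _ => u b).run A Φ x =
      (u (x p)).1 (x t) true * Φ (Function.update x t true) +
      (u (x p)).1 (x t) false * Φ (Function.update x t false) := by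
  rw [run_mux_apply, Fintype.sum_bool, Function.update_of_ne hp]

/-- One summand of a linear combination. If the flag `f` is `1`, then it adds `d` times the state
prepared by the `j`-th routine to the component in which `f` is `0`; the selector `s` has to be
`0` before and is projected to `0` afterwards. -/
noncomputable def addState (f s : Fin a) (j : Fin l) (d : ℂ) (hd : ‖d‖ ^ 2 ≤ 1 / 2) :
    Circuit n a l :=
  .seq (.seq (.seq
    (mux (.inr f) (.inr f) (.inr s) fun b _ => if b = true then loadGate d hd else 1)
    (mux (.inr s) (.inr s) (.inr f) fun b _ => if b = true then pauliX else 1))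
    (.prep j s))
    (mux (.inr f) (.inr f) (.inr s) fun b _ => if b = true then dampGate d hd else hadamard)

/-- Three branches reach `s = 0`: no choice yet (loaded, then damped), an earlier choice, and a new
choice with amplitude `d`. The last two pass through the Hadamard gate with entry `1 / √2`, so all
three carry the same factor and the ratios of the coefficients survive. -/
theorem run_addState_apply (A : Fin l → Unitary (Fin n)) (f s : Fin a) (hfs : f ≠ s) (j : Fin l)
    (d : ℂ) (hd : ‖d‖ ^ 2 ≤ 1 / 2) (Φ : State (Wire n a)) (x : Wire n a → Bool)
    (hxs : x (.inr s) = false)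
    (hΦ : ∀ y : Wire n a → Bool, (∀ p, p ≠ f → p ≠ s → y (.inr p) = x (.inr p)) →
      y (.inr s) = true → Φ y = 0) :
    (addState f s j d hd).run A Φ x = ((√2)⁻¹ : ℝ) * (if x (.inr f) = true then Φ x else
      Φ x + d * ∑ e, (A j).1 (fun i => x (.inl i)) e *
        Φ (Sum.elim e (Function.update (fun p => x (.inr p)) f true))) := by
  have hfs' : (Sum.inr f : Wire n a) ≠ .inr s := by simpa using hfs
  have hus : Function.update x (.inr s) false = x := by rw [← hxs, Function.update_eq_self]
  have load : ∀ y : Wire n a → Bool, (∀ p, p ≠ f → p ≠ s → y (.inr p) = x (.inr p)) →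
      (mux (.inr f) (.inr f) (.inr s) fun b _ => if b = true then loadGate d hd else 1).run A Φ y =
        (if y (.inr f) = true then loadGate d hd else 1).1 (y (.inr s)) false *
          Φ (Function.update y (.inr s) false) := by
    intro y hy
    rw [run_mux_single_apply A _ _ hfs' fun b => if b = true then loadGate d hd else 1,
      hΦ (Function.update y (.inr s) true), mul_zero, zero_add]
    · intro p hpf hps
      rw [Function.update_of_ne (by simpa using hps), hy p hpf hps]
    · simp
  rw [addState, run_seq,
    run_mux_single_apply A _ _ hfs' fun b => if b = true then dampGate d hd else hadamard,
    run_seq, run_prep_apply, run_prep_apply, run_seq, hus, hxs]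
  simp only [Function.update_self, if_true, reduceCtorEq, if_false]
  rw [run_mux_ite_pauliX A _ _ _ hfs'.symm hfs'.symm fun b _ => b, hxs]
  simp only [reduceCtorEq, if_false]
  rw [load x fun _ _ _ => rfl, hus, hxs]
  -- Selector `1` arises only by loading from flag `1`, and the flag is then cleared; hence flag and
  -- selector cannot both be `1` here.
  have cnot : ∀ e : Fin n → Bool,
      (mux (.inr s) (.inr s) (.inr f) fun b _ => if b = true then pauliX else 1).run A
        ((mux (.inr f) (.inr f) (.inr s) fun b _ =>
          if b = true then loadGate d hd else 1).run A Φ)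
        (Sum.elim e fun p => Function.update x (.inr s) true (.inr p)) =
      if x (.inr f) = true then 0 else
        d * Φ (Sum.elim e (Function.update (fun p => x (.inr p)) f true)) := by
    intro e
    rw [run_mux_ite_pauliX A _ _ _ hfs'.symm hfs'.symm fun b _ => b,
      if_pos (by simp), load]
    · rw [Function.update_self, Function.update_of_ne hfs'.symm]
      simp only [Sum.elim_inr, Function.update_self, Function.update_of_ne hfs']
      by_cases hf : x (.inr f) = true
      · simp only [hf, Bool.not_true, reduceCtorEq, if_false, if_true, OneMemClass.coe_one,
          Matrix.one_apply, zero_mul]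
      · rw [if_neg hf]
        rw [Bool.not_eq_true] at hf
        simp only [hf, Bool.not_false, if_true, loadGate, oneQubit_apply, reduceCtorEq, if_false]
        refine congrArg (d * Φ.ofLp ·) ?_
        funext w
        rcases w with i | p
        · simp only [Function.update_of_ne Sum.inl_ne_inr, Sum.elim_inl]
        · simp only [Function.update_apply, Sum.elim_inr, Sum.inr.injEq]
          by_cases hps : p = s
          · rw [if_pos hps, if_neg (by rw [hps]; exact hfs.symm), hps, hxs]
          · simp only [if_neg hps]
    · intro p hpf hps
      simp [Function.update_apply, hps, hpf]
  simp only [cnot]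
  by_cases hf : x (.inr f) = true
  · simp only [if_pos hf, mul_zero, Finset.sum_const_zero, zero_add]
    rw [← mul_assoc, dampGate_mul_loadGate]
  · simp only [if_neg hf, hadamard, oneQubit_apply, reduceCtorEq, if_false, if_true]
    simp only [Finset.mul_sum, OneMemClass.coe_one, Matrix.one_apply, if_true, one_mul, mul_add]
    rw [add_comm]
    congr 1
    refine Finset.sum_congr rfl fun e _ => ?_
    rw [Complex.star_def, Complex.conj_ofReal]
    simp only [Function.update_of_ne (Sum.inl_ne_inr)]
    ring

/-- Prepares a state in which the component with all ancillas equal to `0` is proportional to the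
linear combination with coefficients `d` of the states with indices in `L`. -/
noncomputable def combine (f : Fin a) (s : Fin l → Fin a) (d : Fin l → ℂ)
    (hd : ∀ j, ‖d j‖ ^ 2 ≤ 1 / 2) : List (Fin l) → Circuit n a l
  | [] => mux (.inr f) (.inr f) (.inr f) fun _ _ => pauliX
  | j :: L => .seq (combine f s d hd L) (addState f (s j) j (d j) (hd j))

theorem combine_isExact (f : Fin a) (s : Fin l → Fin a) (d : Fin l → ℂ)
    (hd : ∀ j, ‖d j‖ ^ 2 ≤ 1 / 2) (L : List (Fin l)) :
    (combine f s d hd L : Circuit n a l).IsExact := by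
  induction L with
  | nil => trivial
  | cons j L ih => exact ⟨ih, ⟨⟨⟨trivial, trivial⟩, trivial⟩, trivial⟩⟩

theorem combine_avoids (f : Fin a) (s : Fin l → Fin a) (d : Fin l → ℂ)
    (hd : ∀ j, ‖d j‖ ^ 2 ≤ 1 / 2) (L : List (Fin l)) (w : Fin a) (hf : w ≠ f)
    (hs : ∀ j, w ≠ s j) : (combine f s d hd L : Circuit n a l).Avoids w := by
  have hf' : (Sum.inr w : Wire n a) ≠ .inr f := by simpa using hf
  have hs' : ∀ j, (Sum.inr w : Wire n a) ≠ .inr (s j) := fun j => by simpa using hs j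
  induction L with
  | nil => exact mux_avoids _ _ _ _ _ hf' hf' hf'
  | cons j L ih =>
    exact ⟨ih, ⟨⟨⟨mux_avoids _ _ _ _ _ hf' hf' (hs' j), mux_avoids _ _ _ _ _ (hs' j) (hs' j) hf'⟩,
      trivial⟩, mux_avoids _ _ _ _ _ hf' hf' (hs' j)⟩⟩

theorem time_combine (κ Tin : ℝ) (f : Fin a) (s : Fin l → Fin a) (d : Fin l → ℂ)
    (hd : ∀ j, ‖d j‖ ^ 2 ≤ 1 / 2) (L : List (Fin l)) :
    (combine f s d hd L : Circuit n a l).time κ Tin = L.length * (Tin + 3) + 1 := by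
  induction L with
  | nil => simp [combine, time_mux]
  | cons j L ih =>
    simp only [combine, addState, Circuit.time, ih, time_mux, List.length_cons]
    push_cast
    ring

/-- The branch with flag `1` still holds `|0…0⟩`, the input that every later routine needs. Only
entries whose used selectors are `0` are tracked; the rest is discarded by the amplification. -/
theorem run_combine_ket0_apply (A : Fin l → Unitary (Fin n)) (f : Fin a) (s : Fin l → Fin a)
    (hs : Function.Injective s) (hf : ∀ j, f ≠ s j) (d : Fin l → ℂ)
    (hd : ∀ j, ‖d j‖ ^ 2 ≤ 1 / 2) (L : List (Fin l)) (hL : L.Nodup) (x : Wire n a → Bool)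
    (hx : ∀ j ∈ L, x (.inr (s j)) = false) :
    (combine f s d hd L).run A (ket0 _) x =
      if ∀ p, p ≠ f → x (.inr p) = false then
        (((√2)⁻¹ : ℝ) : ℂ) ^ L.length *
          (if x (.inr f) = true then ket0 (Fin n) fun i => x (.inl i) else
            (L.map fun j => d j * op (A j).1 (ket0 (Fin n)) fun i => x (.inl i)).sum)
      else 0 := by
  induction L generalizing x with
  | nil =>
    rw [combine, run_mux_pauliX]
    simp only [ket0_apply, List.length_nil, pow_zero, one_mul, List.map_nil, List.sum_nil,
      ← ite_and]
    have hiff : (∀ i, Function.update x (.inr f) (!x (.inr f)) i = false) ↔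
        (∀ p, p ≠ f → x (.inr p) = false) ∧ x (.inr f) = true ∧ ∀ i, x (.inl i) = false := by
      constructor
      · intro h
        refine ⟨fun p hp => by simpa [hp] using h (.inr p), by simpa using h (.inr f),
          fun i => by simpa using h (.inl i)⟩
      · rintro ⟨h1, h2, h3⟩ (i | p)
        · simp [h3]
        · by_cases hp : p = f
          · subst hp; simp [h2]
          · simp [hp, h1]
    split_ifs with h1 h2 h2
    · rfl
    · exact absurd (hiff.1 h1) h2
    · exact absurd (hiff.2 h2) h1
    · rfl
  | cons j L ih =>
    rw [List.nodup_cons] at hL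
    rw [List.forall_mem_cons] at hx
    have hsj : ∀ i ∈ L, s i ≠ s j := fun i hi e => hL.1 (hs e ▸ hi)
    rw [combine, run_seq, run_addState_apply A f (s j) (hf j) j (d j) (hd j) _ x hx.1]
    · by_cases hE : ∀ p, p ≠ f → x (.inr p) = false
      · rw [if_pos hE, ih hL.2 x hx.2, if_pos hE]
        by_cases hxf : x (.inr f) = true
        · simp only [if_pos hxf, List.length_cons, pow_succ]; ring
        · simp only [if_neg hxf, List.map_cons, List.sum_cons, List.length_cons, pow_succ]
          have : ∀ e : Fin n → Bool, (combine f s d hd L).run A (ket0 _)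
              (Sum.elim e (Function.update (fun p => x (.inr p)) f true)) =
              (((√2)⁻¹ : ℝ) : ℂ) ^ L.length * ket0 (Fin n) e := by
            intro e
            rw [ih hL.2, if_pos]
            · simp
            · intro p hp
              simp [Function.update_of_ne hp, hE p hp]
            · intro i hi
              simp [Function.update_of_ne (hf i).symm, hx.2 i hi]
          simp only [this, op_apply]
          simp only [Finset.mul_sum, mul_add]
          rw [add_comm]
          congr 1
          · refine Finset.sum_congr rfl fun e _ => ?_
            ring
          · ring
      · have hE' : ∀ y : Wire n a → Bool, (∀ p, p ≠ f → y (.inr p) = x (.inr p)) →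
            (combine f s d hd L).run A (ket0 _) y = 0 := by
          intro y hy
          rw [ih hL.2 y fun i hi => by rw [hy _ (hf i).symm, hx.2 i hi], if_neg]
          exact fun h => hE fun p hp => by rw [← hy p hp, h p hp]
        rw [if_neg hE, hE' x fun _ _ => rfl]
        have : ∀ e : Fin n → Bool, (combine f s d hd L).run A (ket0 _)
            (Sum.elim e (Function.update (fun p => x (.inr p)) f true)) = 0 := fun e =>
          hE' _ fun p hp => by simp [Function.update_of_ne hp]
        simp [this]
    -- The selector of `j` is still unused, so the entries where it is `1` vanish.
    · intro y hy hyj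
      rw [ih hL.2 y fun i hi => by rw [hy _ (hf i).symm (hsj i hi), hx.2 i hi], if_neg]
      intro h
      rw [h _ (hf j).symm] at hyj
      simp at hyj

end Combination

/-! ### Adjoining clean ancillas -/

section Embedding

variable {n a : ℕ}

theorem withAncilla_apply (y : State (Fin n)) (x : Wire n a → Bool) :
    withAncilla a y x =
      if ∀ q, x (Sum.inr q) = false then y (fun i => x (Sum.inl i)) else 0 := rfl

theorem withAncilla_smul (c : ℂ) (y : State (Fin n)) :
    withAncilla a (c • y) = c • withAncilla a y := by
  ext x
  simp [withAncilla_apply]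

theorem sum_withAncilla (y : State (Fin n)) (F : ℂ → (Wire n a → Bool) → ℂ)
    (hF : ∀ x, F 0 x = 0) :
    ∑ x, F (withAncilla a y x) x = ∑ e, F (y e) (Sum.elim e fun _ => false) := by
  rw [← (Equiv.sumArrowEquivProdArrow (Fin n) (Fin a) Bool).symm.sum_comp, Fintype.sum_prod_type]
  refine Finset.sum_congr rfl fun e _ => ?_
  rw [Finset.sum_eq_single fun _ => false]
  · simp [withAncilla_apply, Equiv.sumArrowEquivProdArrow]
  · intro b _ hb
    rw [withAncilla_apply, if_neg, hF]
    intro h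
    exact hb (funext h)
  · simp

theorem norm_withAncilla (y : State (Fin n)) : ‖withAncilla a y‖ = ‖y‖ := by
  have := sum_withAncilla (a := a) y (fun z _ => ((‖z‖ ^ 2 : ℝ) : ℂ)) (by simp)
  rw [EuclideanSpace.norm_eq, EuclideanSpace.norm_eq]
  congr 1
  exact_mod_cast this

end Embedding

/-! ### The rotation by two reflections and its half power -/

section Amplification

variable {n a l : ℕ}

theorem run_sub (A : Fin l → Unitary (Fin n)) (c : Circuit n a l) (Φ Ψ : State (Wire n a)) :
    c.run A (Φ - Ψ) = c.run A Φ - c.run A Ψ := map_sub _ _ _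

theorem run_smul (A : Fin l → Unitary (Fin n)) (c : Circuit n a l) (k : ℂ)
    (Φ : State (Wire n a)) : c.run A (k • Φ) = k • c.run A Φ := map_smul _ _ _

/-- The product of the reflection about the state prepared by `B` and the reflection about the
states in which all qubits in `L` are `0`. The list `L'` consists of the other qubits, apart from
the work qubits. -/
noncomputable def amplifier (B : Circuit n a l) (t : ℕ → Wire n a) (L L' : List (Wire n a)) :
    Circuit n a l :=
  .seq (.seq (.seq B.inv (flipZero t (L ++ L'))) B) (flipZero t L)

theorem amplifier_isExact {B : Circuit n a l} (hB : B.IsExact) (t : ℕ → Wire n a)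
    (L L' : List (Wire n a)) : (amplifier B t L L').IsExact :=
  ⟨⟨⟨hB.inv, flipZero_isExact _ _⟩, hB⟩, flipZero_isExact _ _⟩

theorem time_amplifier (κ Tin : ℝ) (B : Circuit n a l) (t : ℕ → Wire n a)
    (L L' : List (Wire n a)) : (amplifier B t L L').time κ Tin =
      2 * B.time κ Tin + (4 * L.length + 2 * L'.length + 6) := by
  simp only [amplifier, Circuit.time, Circuit.time_inv, time_flipZero, List.length_append]
  push_cast
  ring

/-- One exact half power of the amplifier maps the prepared state to its normalized component with
vanishing ancillas, whatever the norm of this component. -/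
theorem fracPower_amplifier_apply (A : Fin l → Unitary (Fin n)) {B : Circuit n a l}
    (hB : B.IsExact) (t : ℕ → Fin a) {m : ℕ} (ht : ∀ i j, i < j → j ≤ m → t i ≠ t j)
    (L : List (Fin a)) (hm : L.length + n ≤ m) (hL : ∀ q ∈ L, ∀ i ≤ m, q ≠ t i)
    (hcover : ∀ p, p ∈ L ∨ ∃ i ≤ m, p = t i) (hBt : ∀ i ≤ m, B.Avoids (t i))
    (y : State (Fin n)) (hy : y ≠ 0) (w : ℝ) (hw : 0 < w)
    (hψ : ∀ x : Wire n a → Bool, (∀ q, x (.inr q) = false) →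
      B.run A (ket0 _) x = w * y fun i => x (.inl i)) :
    fracPower ((amplifier B (fun i => .inr (t i)) (L.map .inr)
      ((List.finRange n).map .inl)).sem A) (1 / 2) (B.run A (ket0 _)) =
        withAncilla a (((‖y‖⁻¹ : ℝ) : ℂ) • y) := by
  set ψ := B.run A (ket0 _) with hψ_def
  set G := withAncilla a y with hG
  set LP : List (Wire n a) := L.map .inr with hLP
  set LD : List (Wire n a) := (List.finRange n).map .inl with hLD
  set t' : ℕ → Wire n a := fun i => .inr (t i) with ht'_def
  have hny : 0 < ‖y‖ := norm_pos_iff.2 hy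
  have ht' : ∀ i j, i < j → j ≤ m → t' i ≠ t' j := fun i j h1 h2 h =>
    ht i j h1 h2 (Sum.inr_injective h)
  have hLP' : ∀ q ∈ LP, ∀ i ≤ m, q ≠ t' i := by
    intro q hq i hi h
    obtain ⟨p, hp, rfl⟩ := List.mem_map.1 hq
    exact hL p hp i hi (Sum.inr_injective h)
  have hLD' : ∀ q ∈ LP ++ LD, ∀ i ≤ m, q ≠ t' i := by
    intro q hq i hi h
    rcases List.mem_append.1 hq with hq | hq
    · exact hLP' q hq i hi h
    · obtain ⟨p, hp, rfl⟩ := List.mem_map.1 hq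
      simp [t'] at h
  have hlenP : LP.length ≤ m := by simp only [LP, List.length_map]; omega
  have hlenD : (LP ++ LD).length ≤ m := by
    simp only [LP, LD, List.length_append, List.length_map, List.length_finRange]; omega
  have hzeroP : ∀ x : Wire n a → Bool, (∀ q ∈ LP, x q = false) → (∀ i ≤ m, x (t' i) = false) →
      ∀ q, x (.inr q) = false := by
    intro x h1 h2 q
    rcases hcover q with hq | ⟨i, hi, rfl⟩
    · exact h1 _ (List.mem_map_of_mem hq)
    · exact h2 i hi
  have supp0 : ∀ i ≤ m, ∀ x : Wire n a → Bool, x (t' i) = true → ket0 (Wire n a) x = 0 := by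
    intro i hi x hx
    rw [ket0_apply, if_neg]
    intro h
    rw [h] at hx
    simp at hx
  have suppψ : ∀ i ≤ m, ∀ x : Wire n a → Bool, x (t' i) = true → ψ x = 0 := fun i hi =>
    (hBt i hi).run_support A _ (supp0 i hi)
  have suppG : ∀ i ≤ m, ∀ x : Wire n a → Bool, x (t' i) = true → G x = 0 := by
    intro i hi x hx
    rw [hG, withAncilla_apply, if_neg]
    intro h
    rw [h (t i)] at hx
    simp at hx
  -- With clean work qubits, this flip subtracts twice the component with vanishing ancillas, which
  -- for `ψ` is `w • G`.
  have flipψ : (flipZero t' LP).run A ψ = ψ - (2 * w : ℂ) • G := by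
    ext x
    rw [run_flipZero_apply A t' ht' LP hlenP hLP' ψ suppψ]
    change _ = ψ x - (2 * w : ℂ) * G x
    by_cases hx : ∀ i ≤ m, x (t' i) = false
    · by_cases hP : ∀ q ∈ LP, x q = false
      · rw [if_pos hP, hG, withAncilla_apply, if_pos (hzeroP x hP hx), hψ x (hzeroP x hP hx)]
        ring
      · rw [if_neg hP, hG, withAncilla_apply, if_neg, mul_zero, sub_zero]
        intro h
        apply hP
        intro q hq
        obtain ⟨p, hp, rfl⟩ := List.mem_map.1 hq
        exact h p
    · push Not at hx
      obtain ⟨i, hi, hxi⟩ := hx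
      replace hxi := eq_true_of_ne_false hxi
      rw [suppψ i hi x hxi, suppG i hi x hxi]
      simp
  have flipG : (flipZero t' LP).run A G = -G := by
    ext x
    rw [run_flipZero_apply A t' ht' LP hlenP hLP' G suppG]
    change _ = -G x
    split_ifs with hP
    · rfl
    · have : G x = 0 := by
        rw [hG, withAncilla_apply, if_neg]
        intro h
        apply hP
        intro q hq
        obtain ⟨p, hp, rfl⟩ := List.mem_map.1 hq
        exact h p
      rw [this, neg_zero]
  -- With the data qubits in the list, only `|0…0⟩` changes sign: a reflection in one direction.
  have flip0 : ∀ Φ : State (Wire n a), (∀ i ≤ m, ∀ x, x (t' i) = true → Φ x = 0) →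
      (flipZero t' (LP ++ LD)).run A Φ = Φ - (2 * inner ℂ (ket0 _) Φ : ℂ) • ket0 _ := by
    intro Φ hΦ
    ext x
    rw [run_flipZero_apply A t' ht' _ hlenD hLD' Φ hΦ]
    change _ = Φ x - (2 * inner ℂ (ket0 _) Φ : ℂ) * ket0 _ x
    by_cases hx : ∀ i ≤ m, x (t' i) = false
    · by_cases hP : ∀ q ∈ LP ++ LD, x q = false
      · have h0 : ∀ q, x q = false := by
          rw [List.forall_mem_append] at hP
          rintro (i | q)
          · exact hP.2 _ (List.mem_map_of_mem (List.mem_finRange i))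
          · exact hzeroP x hP.1 hx q
        have hx0 : x = fun _ => false := funext h0
        rw [if_pos hP, ket0_apply, if_pos h0, ket0, EuclideanSpace.inner_single_left, hx0]
        simp
        ring
      · rw [if_neg hP, ket0_apply, if_neg fun h => hP fun q _ => h q, mul_zero, sub_zero]
    · push Not at hx
      obtain ⟨i, hi, hxi⟩ := hx
      replace hxi := eq_true_of_ne_false hxi
      rw [hΦ i hi x hxi, supp0 i hi x hxi]
      simp
  -- Unitarity of `B` turns this into the inner product of `ψ` and `G`, to which only entries with
  -- vanishing ancillas contribute.
  have innerG : inner ℂ (ket0 _) (B.inv.run A G) = ((w * ‖y‖ ^ 2 : ℝ) : ℂ) := by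
    have h1 : inner ℂ (ket0 _) (B.inv.run A G) = inner ℂ ψ G := by
      rw [← inner_op_apply (B.sem A)]
      change inner ℂ ψ (B.run A (B.inv.run A G)) = _
      rw [run_run_inv A hB]
    have h2 : inner ℂ ψ G = (w : ℂ) * inner ℂ G G := by
      simp only [PiLp.inner_apply, RCLike.inner_apply, Finset.mul_sum]
      refine Finset.sum_congr rfl fun x _ => ?_
      by_cases hx : ∀ q, x (.inr q) = false
      · have : ψ x = w * G x := by rw [hψ x hx, hG, withAncilla_apply, if_pos hx]
        rw [this, map_mul, Complex.conj_ofReal]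
        ring
      · have : G x = 0 := by rw [hG, withAncilla_apply, if_neg hx]
        simp [this]
    rw [h1, h2, inner_self_eq_norm_sq_to_K, hG, norm_withAncilla]
    push_cast
    rfl
  have reflψ : B.run A ((flipZero t' (LP ++ LD)).run A (B.inv.run A ψ)) = -ψ := by
    rw [hψ_def, run_inv_run A hB, flip0 _ supp0, inner_self_eq_norm_sq_to_K, norm_ket0, run_sub,
      run_smul]
    rw [← hψ_def]
    simp only [RCLike.ofReal_one, one_pow, mul_one]
    module
  have reflG : B.run A ((flipZero t' (LP ++ LD)).run A (B.inv.run A G)) =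
      G - (2 * w * ‖y‖ ^ 2 : ℂ) • ψ := by
    rw [flip0 _ fun i hi => (hBt i hi).inv.run_support A _ (suppG i hi), innerG, run_sub,
      run_smul, run_run_inv A hB, ← hψ_def]
    push_cast
    rw [mul_assoc]
  set R := amplifier B t' LP LD with hR
  -- The mirror image of `ψ` in the line of `G`, whose projection of `ψ` is `w • G`.
  have hRψ : R.run A ψ = (2 * w : ℂ) • G - ψ := by
    rw [hR, amplifier, run_seq, run_seq, run_seq, reflψ, ← neg_one_smul ℂ ψ, run_smul, flipψ]
    module
  have hRG : R.run A G = (4 * w ^ 2 * ‖y‖ ^ 2 - 1 : ℂ) • G - (2 * w * ‖y‖ ^ 2 : ℂ) • ψ := by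
    rw [hR, amplifier, run_seq, run_seq, run_seq, reflG, run_sub, run_smul, flipψ, flipG]
    module
  -- `w * ‖y‖` is the cosine of the angle between `ψ` and `G`; the sum of `ψ` and its mirror image
  -- is a multiple of `G`.
  rw [fracPower_half_apply (R.sem A) ψ (w * ‖y‖) (by positivity)]
  · change _ • (ψ + R.run A ψ) = _
    rw [hRψ, withAncilla_smul, ← hG, add_sub_cancel, smul_smul]
    congr 1
    push_cast
    have h1 : (w : ℂ) ≠ 0 := by exact_mod_cast hw.ne'
    have h2 : (‖y‖ : ℂ) ≠ 0 := by exact_mod_cast hny.ne'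
    field_simp
  · change R.run A (R.run A ψ) + ψ = _ • R.run A ψ
    rw [hRψ, run_sub, run_smul, hRψ, hRG]
    push_cast
    module

/-- The exact parts have only one outcome, so the operator error `δ` is incurred once, on a unit
vector. -/
theorem Implements.norm_sub_le (A : Fin l → Unitary (Fin n)) {B R : Circuit n a l}
    (hB : B.IsExact) (hR : R.IsExact) {r : ℝ} {hr : 0 ≤ r ∧ r ≤ 1} {δ : ℝ} {hδ : 0 < δ ∧ δ ≤ 1}
    {V : Unitary (Wire n a)} (hV : Implements A (.seq B (.frac R r hr δ hδ)) V) :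
    ‖op V.1 (ket0 _) - fracPower (R.sem A) r (B.run A (ket0 _))‖ ≤ δ := by
  cases hV with
  | seq _ _ V W h1 h2 =>
    rw [h1.eq_sem hB]
    cases h2 with
    | frac _ _ _ _ _ U _ hU hW =>
      rw [hU.eq_sem hR] at hW
      have h3 : op (W * B.sem A).1 (ket0 _) = op W.1 (B.run A (ket0 _)) := op_mul_apply _ _ _
      rw [h3, ← sub_apply]
      refine (ContinuousLinearMap.le_of_opNorm_le _ hW _).trans ?_
      rw [Circuit.run, norm_op_apply, norm_ket0, mul_one]

end Amplification

/-! ### Register layout, the full circuit and its cost -/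

section Assembly

variable (n l : ℕ)

/-- The flag that is `1` while no state has been chosen. -/
def flag : Fin (l + 1 + (n + l + 2)) := Fin.castAdd _ (Fin.last l)

/-- The selector of the `j`-th state. -/
def selector (j : Fin l) : Fin (l + 1 + (n + l + 2)) := Fin.castAdd _ j.castSucc

/-- The work qubits of the reflections. -/
def work (i : ℕ) : Fin (l + 1 + (n + l + 2)) := Fin.natAdd _ (Fin.ofNat (n + l + 2) i)

/-- The flag and all selectors. -/
def flagSelectors : List (Fin (l + 1 + (n + l + 2))) :=
  (List.finRange (l + 1)).map (Fin.castAdd _)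

theorem length_flagSelectors : (flagSelectors n l).length = l + 1 := by
  simp [flagSelectors]

theorem castAdd_ne_work (k : Fin (l + 1)) (i : ℕ) : Fin.castAdd (n + l + 2) k ≠ work n l i := by
  intro h
  have := congrArg Fin.val h
  simp only [work, Fin.val_castAdd, Fin.val_natAdd] at this
  omega

theorem work_ne_work (i j : ℕ) (hij : i < j) (hj : j ≤ n + l + 1) : work n l i ≠ work n l j := by
  intro h
  have := congrArg Fin.val h
  simp only [work, Fin.val_natAdd, Fin.val_ofNat] at this
  rw [Nat.mod_eq_of_lt (by omega), Nat.mod_eq_of_lt (by omega)] at this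
  omega

theorem mem_flagSelectors_or_work (p : Fin (l + 1 + (n + l + 2))) :
    p ∈ flagSelectors n l ∨ ∃ i ≤ n + l + 1, p = work n l i := by
  refine Fin.addCases (fun k => ?_) (fun k => ?_) p
  · exact Or.inl (List.mem_map_of_mem (List.mem_finRange k))
  · refine Or.inr ⟨k, by omega, ?_⟩
    simp [work]

variable {n l}

/-- The coefficients of a linear combination, scaled so that they are amplitudes of gates. -/
noncomputable def scaled (α : Fin l → ℂ) (j : Fin l) : ℂ :=
  ((2 * (1 + ∑ i, ‖α i‖))⁻¹ : ℝ) * α j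

/-- The summand `1` in the scaling keeps it positive even when all coefficients vanish. The bound `1
/ 2` is what `dampGate` needs for its diagonal entry to be at most `1`. -/
theorem norm_scaled_sq_le (α : Fin l → ℂ) (j : Fin l) : ‖scaled α j‖ ^ 2 ≤ 1 / 2 := by
  have h0 : ‖α j‖ ≤ ∑ i, ‖α i‖ :=
    Finset.single_le_sum (f := fun i => ‖α i‖) (fun i _ => norm_nonneg _) (Finset.mem_univ j)
  have h1 := norm_nonneg (α j)
  have h : ‖scaled α j‖ ≤ 1 / 2 := by
    rw [scaled, norm_mul, Complex.norm_real, Real.norm_eq_abs, abs_of_pos (by positivity),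
      inv_mul_le_iff₀ (by positivity)]
    linarith
  nlinarith [norm_nonneg (scaled α j)]

variable (n) in
/-- Prepares a state whose component with vanishing ancillas is a positive multiple of the linear
combination with coefficients `α`. -/
noncomputable def lcuPrep (α : Fin l → ℂ) : Circuit n (l + 1 + (n + l + 2)) l :=
  combine (flag n l) (selector n l) (scaled α) (norm_scaled_sq_le α) (List.finRange l)

variable (n) in
/-- The amplifier of `lcuPrep`. -/
noncomputable def lcuAmplifier (α : Fin l → ℂ) : Circuit n (l + 1 + (n + l + 2)) l :=
  amplifier (lcuPrep n α) (fun i => .inr (work n l i)) ((flagSelectors n l).map .inr)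
    ((List.finRange n).map .inl)

variable (n) in
/-- Prepares the normalized linear combination with coefficients `α`, with one fractional power. -/
noncomputable def lcuCircuit (α : Fin l → ℂ) (ε : ℝ) (hε : 0 < ε ∧ ε ≤ 1) :
    Circuit n (l + 1 + (n + l + 2)) l :=
  .seq (lcuPrep n α) (.frac (lcuAmplifier n α) (1 / 2) (by norm_num) ε hε)

theorem flag_ne_selector (j : Fin l) : flag n l ≠ selector n l j := by
  intro h
  exact (Fin.castSucc_lt_last j).ne' (Fin.castAdd_injective _ _ h)

theorem selector_injective : Function.Injective (selector n l) :=
  (Fin.castAdd_injective _ _).comp (Fin.castSucc_injective l)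

theorem norm_lcuCircuit_sub_le (α : Fin l → ℂ) (ε : ℝ) (hε : 0 < ε ∧ ε ≤ 1)
    (A : Fin l → Unitary (Fin n)) (y : State (Fin n))
    (hy : y = ∑ j, α j • op (A j).1 (ket0 (Fin n))) (hy0 : y ≠ 0)
    (V : Unitary (Wire n (l + 1 + (n + l + 2)))) (hV : Implements A (lcuCircuit n α ε hε) V) :
    ‖op V.1 (ket0 _) - withAncilla _ (((‖y‖⁻¹ : ℝ) : ℂ) • y)‖ ≤ ε := by
  have hB : (lcuPrep n α).IsExact := combine_isExact _ _ _ _ _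
  -- One factor `1 / √2` for each state, times the scaling of the coefficients.
  have hw : 0 < (√2)⁻¹ ^ l * (2 * (1 + ∑ i, ‖α i‖))⁻¹ := by positivity
  -- The longest flipped list has `l + 1` flag and selector qubits and `n` data qubits, so the last
  -- work index is `n + l + 1`.
  rw [← fracPower_amplifier_apply A hB (work n l) (m := n + l + 1) (work_ne_work n l)
    (flagSelectors n l) (by rw [length_flagSelectors]; omega) ?_ (mem_flagSelectors_or_work n l)
    ?_ y hy0 _ hw ?_]
  · exact hV.norm_sub_le A hB (amplifier_isExact hB _ _ _)
  · intro q hq i _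
    obtain ⟨k, _, rfl⟩ := List.mem_map.1 hq
    exact castAdd_ne_work n l k i
  · intro i _
    exact combine_avoids _ _ _ _ _ _ (castAdd_ne_work n l _ i).symm
      fun j => (castAdd_ne_work n l _ i).symm
  · intro x hx
    rw [lcuPrep, run_combine_ket0_apply A _ _ selector_injective flag_ne_selector _ _ _
      (List.nodup_finRange l) x fun j _ => hx _, if_pos fun p _ => hx p, if_neg (by simp [hx]),
      List.length_finRange, ← List.ofFn_eq_map, List.sum_ofFn, hy]
    simp only [scaled, WithLp.ofLp_sum, WithLp.ofLp_smul, Finset.sum_apply, Pi.smul_apply,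
      smul_eq_mul, Finset.mul_sum]
    refine Finset.sum_congr rfl fun j _ => ?_
    push_cast
    ring

/-- As `1` and `n` are at most `Tin`, the preparation costs at most `5 * l * Tin` and the amplifier
at most `26 * l * Tin`; only the latter really incurs the factor `κ / ε`. -/
theorem time_lcuCircuit_le {κ : ℝ} (hκ : 0 < κ) (hl : 0 < l) (α : Fin l → ℂ) (ε : ℝ)
    (hε : 0 < ε ∧ ε ≤ 1) {Tin : ℝ} (h1 : 1 ≤ Tin) (hn : (n : ℝ) ≤ Tin) :
    (lcuCircuit n α ε hε).time κ Tin ≤ (5 + 26 * κ) * (Tin * (l / ε)) := by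
  have hl1 : (1 : ℝ) ≤ l := by exact_mod_cast hl
  have hB : (lcuPrep n α).time κ Tin = l * (Tin + 3) + 1 := by
    rw [lcuPrep, time_combine, List.length_finRange]
  have hlT : (l : ℝ) ≤ l * Tin := le_mul_of_one_le_right (by linarith) h1
  have hTl : Tin ≤ l * Tin := le_mul_of_one_le_left (by linarith) hl1
  have hB' : (lcuPrep n α).time κ Tin ≤ 5 * (l * Tin) := by rw [hB]; linarith
  have hR : (lcuAmplifier n α).time κ Tin ≤ 26 * (l * Tin) := by
    rw [lcuAmplifier, time_amplifier, List.length_map, List.length_map, length_flagSelectors,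
      List.length_finRange]
    push_cast
    linarith
  have hε' : 1 ≤ 1 / ε := by rw [le_div_iff₀ hε.1]; linarith [hε.2]
  calc (lcuCircuit n α ε hε).time κ Tin
      = (lcuPrep n α).time κ Tin + κ * (lcuAmplifier n α).time κ Tin * (1 / ε) := by
        simp only [lcuCircuit, Circuit.time]; ring
    _ ≤ 5 * (l * Tin) * (1 / ε) + κ * (26 * (l * Tin)) * (1 / ε) := by
        gcongr
        exact hB'.trans (le_mul_of_one_le_right (by positivity) hε')
    _ = _ := by ring

theorem le_rpow_logb {x y : ℝ} (hx : 2 ≤ x) (hy : 1 ≤ y) : y ≤ x ^ Real.logb 2 y := by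
  calc y = 2 ^ Real.logb 2 y := (Real.rpow_logb two_pos (by norm_num) (by linarith)).symm
    _ ≤ _ := Real.rpow_le_rpow two_pos.le hx (Real.logb_nonneg one_lt_two hy)

end Assembly

/-! ### A single state -/

section OneState

variable {n : ℕ}

/-- Prepares a single state, up to the phase `z`. -/
noncomputable def phasePrep (n : ℕ) (z : ℂ) (hz : ‖z‖ = 1) : Circuit n 1 1 :=
  .seq (.seq (mux (.inr 0) (.inr 0) (.inr 0) fun _ _ => pauliX) (.prep 0 0))
    (mux (.inr 0) (.inr 0) (.inr 0) fun _ _ => oneQubit (-z) 0 1 (by simpa using hz) (by simp))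

theorem phasePrep_isExact (z : ℂ) (hz : ‖z‖ = 1) : (phasePrep n z hz).IsExact :=
  ⟨⟨trivial, trivial⟩, trivial⟩

theorem time_phasePrep (κ Tin : ℝ) (z : ℂ) (hz : ‖z‖ = 1) :
    (phasePrep n z hz).time κ Tin = Tin + 2 := by
  simp only [phasePrep, Circuit.time, time_mux]; ring

/-- The ancilla is set to `1` to enable the call; the last gate maps `|1⟩` to `z|0⟩`, which cleans
it and supplies the phase. -/
theorem run_phasePrep (A : Fin 1 → Unitary (Fin n)) (z : ℂ) (hz : ‖z‖ = 1) :
    (phasePrep n z hz).run A (ket0 _) = withAncilla 1 (z • op (A 0).1 (ket0 (Fin n))) := by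
  have h1 : ∀ x : Wire n 1 → Bool, (Circuit.seq (mux (.inr 0) (.inr 0) (.inr 0) fun _ _ => pauliX)
      (.prep 0 0)).run A (ket0 _) x =
        if x (.inr 0) = true then op (A 0).1 (ket0 (Fin n)) fun i => x (.inl i) else 0 := by
    intro x
    rw [run_seq, run_prep_apply]
    by_cases hx : x (.inr 0) = true
    · rw [if_pos hx, if_pos hx, op_apply]
      refine Finset.sum_congr rfl fun e _ => ?_
      rw [run_mux_pauliX, ket0_apply, ket0_apply]
      congr 1
      simp [Sum.forall, hx, Function.update_apply]
    · rw [if_neg hx, if_neg hx, run_mux_pauliX, ket0_apply, if_neg]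
      intro h
      have := h (.inr 0)
      simp [hx] at this
  ext x
  rw [phasePrep, run_seq, run_mux_apply, Fintype.sum_bool, h1, h1, withAncilla_apply]
  cases hx : x (.inr 0) <;> simp [hx, oneQubit_apply]

end OneState

end QCircuit

/-! ### The theorem -/

theorem mainTheorem3 (κ : ℝ) (hκ : 0 < κ) :
    ∃ K : ℝ, 0 < K ∧
      ∀ (l n : ℕ) (_hl : 0 < l) (α : Fin l → ℂ) (ε : ℝ) (_hε : 0 < ε) (_hε1 : ε ≤ 1),
        ∃ (a : ℕ) (c : QCircuit.Circuit n a l),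
          (∀ Tin : ℝ, 1 ≤ Tin → (n : ℝ) ≤ Tin →
            c.time κ Tin ≤ K * (Tin * (l : ℝ) ^ Real.logb 2 ((l : ℝ) / ε))) ∧
          ∀ (v : Fin l → QCircuit.State (Fin n)) (A : Fin l → QCircuit.Unitary (Fin n)),
            (∀ j, QCircuit.op (A j).1 (QCircuit.ket0 (Fin n)) = v j) →
            ∑ j, α j • v j ≠ 0 →
            ∀ V : QCircuit.Unitary (QCircuit.Wire n a), QCircuit.Implements A c V →
              ‖QCircuit.op V.1 (QCircuit.ket0 (QCircuit.Wire n a)) -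
                QCircuit.withAncilla a
                  (((‖∑ j, α j • v j‖⁻¹ : ℝ) : ℂ) • ∑ j, α j • v j)‖ ≤ ε := by
  refine ⟨5 + 26 * κ, by positivity, ?_⟩
  intro l n hl α ε hε hε1
  -- The comparison with a power of `l` requires base at least `2`. For `l = 1` only the phase of
  -- the coefficient survives normalization.
  obtain rfl | hl2 : l = 1 ∨ 2 ≤ l := by omega
  · have hz : ∃ z : ℂ, ‖z‖ = 1 ∧ α 0 = ‖α 0‖ * z :=
      ⟨Complex.exp (Complex.arg (α 0) * Complex.I), Complex.norm_exp_ofReal_mul_I _,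
        (Complex.norm_mul_exp_arg_mul_I _).symm⟩
    obtain ⟨z, hz, hαz⟩ := hz
    refine ⟨1, QCircuit.phasePrep n z hz, ?_, ?_⟩
    · intro Tin h1 _
      rw [QCircuit.time_phasePrep, Nat.cast_one, Real.one_rpow, mul_one]
      nlinarith
    · intro v A hv hv0 V hV
      rw [hV.eq_sem (QCircuit.phasePrep_isExact z hz)]
      change ‖(QCircuit.phasePrep n z hz).run A (QCircuit.ket0 _) - _‖ ≤ ε
      simp only [Fin.sum_univ_one, Fin.isValue] at hv0 ⊢
      have hα : α 0 ≠ 0 := fun h => hv0 (by rw [h, zero_smul])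
      have hnv : ‖v 0‖ = 1 := by rw [← hv 0, QCircuit.norm_op_apply, QCircuit.norm_ket0]
      have : ((‖α 0 • v 0‖⁻¹ : ℝ) : ℂ) • α 0 • v 0 = z • v 0 := by
        have h0 : (‖α 0‖ : ℂ) ≠ 0 := by exact_mod_cast norm_ne_zero_iff.2 hα
        rw [norm_smul, hnv, mul_one, smul_smul]
        congr 1
        nth_rewrite 2 [hαz]
        push_cast
        rw [inv_mul_cancel_left₀ h0]
      rw [QCircuit.run_phasePrep, hv, this, sub_self, norm_zero]
      exact hε.le
  · refine ⟨_, QCircuit.lcuCircuit n α ε ⟨hε, hε1⟩, ?_, ?_⟩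
    · intro Tin h1 hn
      refine (QCircuit.time_lcuCircuit_le hκ hl α ε ⟨hε, hε1⟩ h1 hn).trans ?_
      have h2 : (2 : ℝ) ≤ l := by exact_mod_cast hl2
      have h3 : 1 ≤ (l : ℝ) / ε := by rw [le_div_iff₀ hε]; linarith
      have := QCircuit.le_rpow_logb h2 h3
      gcongr
    · intro v A hv hv0 V hV
      refine QCircuit.norm_lcuCircuit_sub_le α ε ⟨hε, hε1⟩ A _ ?_ hv0 V hV
      simp only [hv]
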